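/- Let $d\in\mathbb N$ and $\alpha\in\mathbb R$ satisfy $\alpha<d<2\alpha$, and let $\mathbb K=\mathbb R$ or $\mathbb K=\mathbb C$. Let $\mathcal R_{d,\alpha}$ be the set of measurable functions $V:\mathbb R^d\to\mathbb K$, identified when they agree almost everywhere, such that $$\|V\|_{\mathcal R_{d,\alpha}}^2:=\int_{\mathbb R^d}\int_{\mathbb R^d}\frac{|V(x)|\,|V(y)|}{|x-y|^{2(d-\alpha)}}\,dx\,dy<\infty .$$ For $V\in\mathcal R_{d,\alpha}$ put $$|||V|||_{\mathcal R_{d,\alpha}}^2:=\int_{\mathbb R^d}\int_{\mathbb R^d}V(x)\overline{V(y)}\,|x-y|^{2\alpha-2d}\,dx\,dy .$$ For $0<\beta<d$ let $$\gamma_d(\beta)=\frac{2^\beta\pi^{d/2}\Gamma(\beta/2)}{\Gamma((d-\beta)/2)},\qquad \mathcal I_\beta f(x)=\frac1{\gamma_d(\beta)}\int_{\mathbb R^d}\frac{f(y)}{|x-y|^{d-\beta}}\,dy .$$ Then $\mathcal R_{d,\alpha}$ is a vector space over $\mathbb K$. For every $V\in\mathcal R_{d,\alpha}$ the double integral defining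 $|||V|||_{\mathcal R_{d,\alpha}}^2$ converges absolutely and is real and nonnegative, so that $|||V|||_{\mathcal R_{d,\alpha}}$ (the nonnegative root) is well defined. Both $\|\cdot\|_{\mathcal R_{d,\alpha}}$ and $|||\cdot|||_{\mathcal R_{d,\alpha}}$ are norms on $\mathcal R_{d,\alpha}$. Furthermore, for every $V\in\mathcal R_{d,\alpha}$ the integrals defining $\mathcal I_{\alpha-d/2}V$ and $\mathcal I_{\alpha-d/2}|V|$ converge absolutely almost everywhere, both potentials belong to $L^2(\mathbb R^d)$, and $$|||V|||_{\mathcal R_{d,\alpha}}^2=\gamma_d(2\alpha-d)\,\|\mathcal I_{\alpha-\frac d2}V\|_2^2,\qquad \|V\|_{\mathcal R_{d,\alpha}}^2=\gamma_d(2\alpha-d)\,\|\mathcal I_{\alpha-\frac d2}|V|\|_2^2 .$$ -/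

import Mathlib

open MeasureTheory
open scoped ENNReal

noncomputable section

/-- The constant `γ_d(β) = 2^β π^{d/2} Γ(β/2) / Γ((d-β)/2)`. -/
def rieszGamma (d : ℕ) (β : ℝ) : ℝ :=
  2 ^ β * Real.pi ^ ((d : ℝ) / 2) * Real.Gamma (β / 2) / Real.Gamma (((d : ℝ) - β) / 2)

/-- The Riesz potential `I_β f (x) = γ_d(β)⁻¹ ∫ f(y) / |x-y|^{d-β} dy` on `ℝ^d`. -/
def rieszPotential {𝕜 : Type*} [RCLike 𝕜] {d : ℕ} (β : ℝ)
    (f : EuclideanSpace ℝ (Fin d) → 𝕜) (x : EuclideanSpace ℝ (Fin d)) : 𝕜 :=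
  (rieszGamma d β)⁻¹ • ∫ y, (‖x - y‖ ^ ((d : ℝ) - β))⁻¹ • f y

/-- The double integral `∫∫ |V(x)| |V(y)| / |x-y|^{2(d-α)} dx dy`, with values in `[0,∞]`. -/
def rollnikIntegral {𝕜 : Type*} [RCLike 𝕜] {d : ℕ} (α : ℝ)
    (V : EuclideanSpace ℝ (Fin d) → 𝕜) : ℝ≥0∞ :=
  ∫⁻ x, ∫⁻ y, ENNReal.ofReal (‖V x‖ * ‖V y‖ / ‖x - y‖ ^ (2 * ((d : ℝ) - α)))

/-- The fractional Rollnik class: the (almost everywhere classes of) measurable functions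
`V : ℝ^d → 𝕜`, with `𝕜 = ℝ` or `ℂ`, for which the double integral above is finite. -/
def rollnikClass (𝕜 : Type*) [RCLike 𝕜] (d : ℕ) (α : ℝ) :
    Set (EuclideanSpace ℝ (Fin d) →ₘ[volume] 𝕜) :=
  {V | rollnikIntegral α V < ∞}

/-- The absolute Rollnik functional `‖V‖ = (∫∫ |V(x)| |V(y)| / |x-y|^{2(d-α)} dx dy)^{1/2}`. -/
def rollnikNorm {𝕜 : Type*} [RCLike 𝕜] {d : ℕ} (α : ℝ)
    (V : EuclideanSpace ℝ (Fin d) →ₘ[volume] 𝕜) : ℝ :=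
  Real.sqrt (rollnikIntegral α V).toReal

/-- The integrand `V(x) conj(V(y)) |x-y|^{2α-2d}` of the signed functional. -/
def rollnikSignedIntegrand {𝕜 : Type*} [RCLike 𝕜] {d : ℕ} (α : ℝ)
    (V : EuclideanSpace ℝ (Fin d) → 𝕜) (x y : EuclideanSpace ℝ (Fin d)) : 𝕜 :=
  (‖x - y‖ ^ (2 * α - 2 * (d : ℝ))) • (V x * (starRingEnd 𝕜) (V y))

/-- The double integral `∫∫ V(x) conj(V(y)) |x-y|^{2α-2d} dx dy`. -/
def rollnikSignedIntegral {𝕜 : Type*} [RCLike 𝕜] {d : ℕ} (α : ℝ)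
    (V : EuclideanSpace ℝ (Fin d) → 𝕜) : 𝕜 :=
  ∫ x, ∫ y, rollnikSignedIntegrand α V x y

/-- The signed Rollnik functional `|||V|||`, the square root of the preceding integral. -/
def rollnikSignedNorm {𝕜 : Type*} [RCLike 𝕜] {d : ℕ} (α : ℝ)
    (V : EuclideanSpace ℝ (Fin d) →ₘ[volume] 𝕜) : ℝ :=
  Real.sqrt (RCLike.re (rollnikSignedIntegral α V))

/-- `N` is a norm on `R`: `R` is a linear subspace of `M`, and on `R` the function `N` is
nonnegative, definite, absolutely homogeneous and subadditive. -/
structure IsNormOn (𝕜 : Type*) [RCLike 𝕜] {M : Type*} [AddCommGroup M] [Module 𝕜 M]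
    (R : Set M) (N : M → ℝ) : Prop where
  zero_mem : (0 : M) ∈ R
  add_mem : ∀ V ∈ R, ∀ W ∈ R, V + W ∈ R
  smul_mem : ∀ (c : 𝕜), ∀ V ∈ R, c • V ∈ R
  nonneg : ∀ V ∈ R, 0 ≤ N V
  eq_zero_iff : ∀ V ∈ R, (N V = 0 ↔ V = 0)
  smul : ∀ (c : 𝕜), ∀ V ∈ R, N (c • V) = ‖c‖ * N V
  add_le : ∀ V ∈ R, ∀ W ∈ R, N (V + W) ≤ N V + N W

end

/-!
Put `β = α - d / 2`, so that `0 < 2β < d`, and let `k(x) = |x|^{β - d}` be the unnormalised Riesz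
kernel. Everything rests on writing the Rollnik kernel `|x - y|^{2α - 2d} = |x - y|^{2β - d}` as a
square, in two different ways.

**The Riesz square.** The composition formula
`∫ k(z - x) k(z - y) dz = γ_d(β)² γ_d(2β)⁻¹ |x - y|^{2β - d}`
(`lintegral_riesz_kernel_mul_riesz_kernel`) holds because each factor is a Mellin integral of
Gaussians `G_u(x) = u^{-d/2} exp(-|x|² / u)`, Gaussians compose by `G_u * G_v = π^{d/2} G_{u+v}`, and
the remaining integral over `u + v = w` is a Beta integral. All integrands are nonnegative, so
Tonelli suffices.

**The general principle.** Whenever `c K(x, y) = ∫ h(ω, x) h(ω, y) dμ(ω)` with `h ≥ 0`, Tonelli gives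
`∫ (∫ h(ω, x) |V(x)| dx)² dμ(ω) = c ∬ K |V| |V|`. If this is finite, then `h(ω, ·) V` is integrable
for almost every `ω`, and Fubini gives `∫ |∫ h(ω, x) V(x) dx|² dμ(ω) = c ∬ K V V̄`
(`integral_sq_norm_integral_smul_eq`). For the Riesz square this is the asserted `L²` identity, for
`V` and for `|V|`; it makes both functionals multiples of `L²` norms of potentials, whence the
triangle inequality.

**Definiteness.** The kernel is also a mixture of products of indicators of balls,
`C |x - y|^{-λ} = ∫_0^∞ ∫ r^{-λ-d-1} 1_{B(z,r)}(x) 1_{B(z,r)}(y) dz dr` with `λ = 2d - 2α`, by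
invariance under similarities (`exists_lintegral_ballKernel_mul_ballKernel`). By the general
principle, if the signed integral of `V` vanishes, then for almost every `r` the integral of `V` over
`B(z, r)` vanishes for almost every `z`, and Lebesgue's differentiation theorem gives `V = 0`
(`ae_eq_zero_of_integral_ballKernel_smul_eq_zero`). The absolute norm dominates the signed one, so
it is definite too.
-/

open scoped ComplexConjugate Pointwise

/-! ### Changes of variables and real integrals as Lebesgue integrals -/

theorem lintegral_image_const_mul {c : ℝ} (hc : 0 < c) {s : Set ℝ} (hs : MeasurableSet s)
    (f : ℝ → ℝ≥0∞) :
    ∫⁻ x in (fun x => c * x) '' s, f x = ENNReal.ofReal c * ∫⁻ x in s, f (c * x) := by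
  have h := lintegral_image_eq_lintegral_abs_deriv_mul (f := fun x => c * x) (f' := fun _ => c) hs
    (fun x _ => by simpa using ((hasDerivAt_id x).const_mul c).hasDerivWithinAt)
    (fun x _ y _ h => mul_left_cancel₀ hc.ne' h) f
  rw [h, abs_of_pos hc, lintegral_const_mul' _ _ ENNReal.ofReal_ne_top]

theorem image_const_mul_Ioi_zero {c : ℝ} (hc : 0 < c) :
    (fun x => c * x) '' Set.Ioi (0 : ℝ) = Set.Ioi 0 := by
  have := Set.image_mul_left_Ioi hc 0
  simpa using this

/-- Integrability is automatic here, since the Bochner integral of a non-integrable function is `0`. -/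
theorem lintegral_ofReal_of_integral_eq {X : Type*} [MeasurableSpace X] {μ : Measure X} {f : X → ℝ}
    (hf : 0 ≤ᵐ[μ] f) {c : ℝ} (hc : c ≠ 0) (h : ∫ x, f x ∂μ = c) :
    ∫⁻ x, ENNReal.ofReal (f x) ∂μ = ENNReal.ofReal c := by
  have hi : Integrable f μ := by
    by_contra hn
    exact hc (h ▸ integral_undef hn)
  rw [← ofReal_integral_eq_lintegral_ofReal hi hf, h]

/-! ### Composition of Riesz kernels by Gaussian subordination -/

/-- The power `ρ ^ (-2a)` as a Mellin integral of Gaussians; the substitution `u ↦ u⁻¹` turns the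
integral into Euler's integral for `Γ(a)`. -/
theorem lintegral_rpow_mul_exp_neg_sq_div {a ρ : ℝ} (ha : 0 < a) (hρ : 0 < ρ) :
    ∫⁻ u in Set.Ioi (0 : ℝ), ENNReal.ofReal (u ^ (-a - 1) * Real.exp (-ρ ^ 2 / u)) =
      ENNReal.ofReal (Real.Gamma a * (ρ ^ (2 * a))⁻¹) := by
  have hG := Real.Gamma_pos_of_pos ha
  apply lintegral_ofReal_of_integral_eq
  · filter_upwards [ae_restrict_mem measurableSet_Ioi] with u hu
    have : (0 : ℝ) < u := hu
    simp only [Pi.zero_apply]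
    positivity
  · positivity
  -- The exponent `p = -1` is the substitution `u ↦ u⁻¹`.
  have h := integral_comp_rpow_Ioi (fun s : ℝ => s ^ (a - 1) * Real.exp (-(ρ ^ 2 * s)))
    (p := -1) (by norm_num)
  rw [Real.integral_rpow_mul_exp_neg_mul_Ioi ha (by positivity)] at h
  calc _ = _ := setIntegral_congr_fun measurableSet_Ioi ?_
    _ = _ := h
    _ = _ := ?_
  · intro u hu
    have hu : (0 : ℝ) < u := hu
    have h1 : u ^ (-a - 1) = u ^ (-2 : ℝ) * (u⁻¹) ^ (a - 1) := by
      rw [Real.inv_rpow hu.le, ← Real.rpow_neg hu.le, ← Real.rpow_add hu]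
      congr 1; ring
    simp only [abs_neg, abs_one, one_mul, smul_eq_mul, Real.rpow_neg_one, h1]
    norm_num
    rw [mul_assoc, neg_div, div_eq_mul_inv]
  · rw [one_div, Real.inv_rpow (by positivity), mul_comm, ← Real.rpow_natCast, ← Real.rpow_mul hρ.le]
    norm_num

/-- The convolution of two Gaussians is a Gaussian, by completing the square around the centre
`(v x + u y) / (u + v)`. -/
theorem lintegral_exp_mul_exp {d : ℕ} {u v : ℝ} (hu : 0 < u) (hv : 0 < v)
    (x y : EuclideanSpace ℝ (Fin d)) :
    ∫⁻ z, ENNReal.ofReal (Real.exp (-‖x - z‖ ^ 2 / u) * Real.exp (-‖z - y‖ ^ 2 / v)) =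
      ENNReal.ofReal ((Real.pi * (u * v / (u + v))) ^ ((d : ℝ) / 2) *
        Real.exp (-‖x - y‖ ^ 2 / (u + v))) := by
  have hpi := Real.pi_pos
  have hb : 0 < (u + v) / (u * v) := by positivity
  apply lintegral_ofReal_of_integral_eq
  · exact Filter.Eventually.of_forall fun z => by simp only [Pi.zero_apply]; positivity
  · positivity
  have key : ∀ z : EuclideanSpace ℝ (Fin d),
      Real.exp (-‖x - z‖ ^ 2 / u) * Real.exp (-‖z - y‖ ^ 2 / v) =
      Real.exp (-((u + v) / (u * v)) * ‖z - ((v / (u + v)) • x + (u / (u + v)) • y)‖ ^ 2) *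
        Real.exp (-‖x - y‖ ^ 2 / (u + v)) := by
    intro z
    rw [← Real.exp_add, ← Real.exp_add]
    congr 1
    have e1 : ‖z - ((v / (u + v)) • x + (u / (u + v)) • y)‖ ^ 2 =
        ‖z‖ ^ 2 - 2 * (v / (u + v) * inner ℝ z x + u / (u + v) * inner ℝ z y) +
        ((v / (u + v)) ^ 2 * ‖x‖ ^ 2 + 2 * (v / (u + v) * (u / (u + v)) * inner ℝ x y)
          + (u / (u + v)) ^ 2 * ‖y‖ ^ 2) := by
      rw [norm_sub_sq_real, norm_add_sq_real, inner_add_right, inner_smul_right, inner_smul_right,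
        real_inner_smul_left, inner_smul_right, norm_smul, norm_smul, mul_pow, mul_pow,
        Real.norm_eq_abs, Real.norm_eq_abs, sq_abs, sq_abs]
      ring
    rw [e1, norm_sub_sq_real, norm_sub_sq_real, norm_sub_sq_real, real_inner_comm x z]
    field_simp
    ring
  simp_rw [key]
  rw [integral_mul_const, integral_sub_right_eq_self
    (fun z => Real.exp (-((u + v) / (u * v)) * ‖z‖ ^ 2)),
    GaussianFourier.integral_rexp_neg_mul_sq_norm hb]
  congr 2
  · field_simp
  · simp

theorem lintegral_Ioo_rpow_mul_sub_rpow {b w : ℝ} (hb : 0 < b) (hw : 0 < w) :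
    ∫⁻ u in Set.Ioo 0 w, ENNReal.ofReal (u ^ (b - 1) * (w - u) ^ (b - 1)) =
      ENNReal.ofReal (ProbabilityTheory.beta b b * w ^ (2 * b - 1)) := by
  have hB := ProbabilityTheory.beta_pos hb hb
  have h1 := ProbabilityTheory.lintegral_betaPDF_eq_one hb hb
  rw [ProbabilityTheory.lintegral_betaPDF] at h1
  have h2 : ∫⁻ x in Set.Ioo (0 : ℝ) 1, ENNReal.ofReal (x ^ (b - 1) * (1 - x) ^ (b - 1)) =
      ENNReal.ofReal (ProbabilityTheory.beta b b) := by
    rw [← mul_one (ENNReal.ofReal (ProbabilityTheory.beta b b)), ← h1,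
      ← lintegral_const_mul' _ _ ENNReal.ofReal_ne_top]
    congr with x
    rw [← ENNReal.ofReal_mul hB.le]
    congr 1
    field_simp
  have him : (fun x => w * x) '' Set.Ioo (0 : ℝ) 1 = Set.Ioo 0 w := by
    simpa using Set.image_mul_left_Ioo hw 0 1
  rw [← him, lintegral_image_const_mul hw measurableSet_Ioo]
  have h3 : ∀ x ∈ Set.Ioo (0 : ℝ) 1,
      ENNReal.ofReal ((w * x) ^ (b - 1) * (w - w * x) ^ (b - 1)) =
      ENNReal.ofReal (w ^ (2 * b - 2)) * ENNReal.ofReal (x ^ (b - 1) * (1 - x) ^ (b - 1)) := by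
    intro x hx
    rw [← ENNReal.ofReal_mul (by positivity), show w - w * x = w * (1 - x) by ring,
      Real.mul_rpow hw.le hx.1.le, Real.mul_rpow hw.le (by linarith [hx.2]),
      show 2 * b - 2 = (b - 1) + (b - 1) by ring, Real.rpow_add hw]
    congr 1; ring
  rw [setLIntegral_congr_fun measurableSet_Ioo h3, lintegral_const_mul' _ _ ENNReal.ofReal_ne_top,
    h2, ← mul_assoc, ← ENNReal.ofReal_mul hw.le, ← ENNReal.ofReal_mul (by positivity)]
  congr 1
  rw [show 2 * b - 1 = 1 + (2 * b - 2) by ring, Real.rpow_add hw, Real.rpow_one]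
  ring

/-- Integration of a function of `u + v` against `u ^ (b - 1) * v ^ (b - 1)`: for fixed `w = u + v`
the integral over `u` is the Beta integral `B(b, b) w ^ (2b - 1)`. -/
theorem lintegral_lintegral_rpow_mul_rpow_mul_add {b : ℝ} (hb : 0 < b) {H : ℝ → ℝ≥0∞}
    (hH : Measurable H) :
    ∫⁻ u in Set.Ioi (0 : ℝ), ∫⁻ v in Set.Ioi (0 : ℝ),
        ENNReal.ofReal (u ^ (b - 1) * v ^ (b - 1)) * H (u + v) =
      ∫⁻ w in Set.Ioi (0 : ℝ), ENNReal.ofReal (ProbabilityTheory.beta b b * w ^ (2 * b - 1)) * H w := by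
  -- The integrand in the variables `u` and `w = u + v`, extended by `0` off `0 < u < w`.
  let F : ℝ → ℝ → ℝ≥0∞ := fun u w =>
    (Set.Ioi (0 : ℝ)).indicator (fun _ => (Set.Ioi u).indicator
      (fun w => ENNReal.ofReal (u ^ (b - 1) * (w - u) ^ (b - 1)) * H w) w) u
  have hFm : Measurable (Function.uncurry F) := by
    have : Function.uncurry F = ({p : ℝ × ℝ | 0 < p.1 ∧ p.1 < p.2}).indicator
        (fun p => ENNReal.ofReal (p.1 ^ (b - 1) * (p.2 - p.1) ^ (b - 1)) * H p.2) := by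
      ext ⟨u, w⟩
      simp only [Function.uncurry, F, Set.indicator_apply, Set.mem_Ioi, Set.mem_ofPred_eq]
      by_cases h1 : 0 < u <;> by_cases h2 : u < w <;> simp [h1, h2]
    rw [this]
    refine Measurable.indicator (by fun_prop) ?_
    exact (measurableSet_lt measurable_const measurable_fst).inter
      (measurableSet_lt measurable_fst measurable_snd)
  have hL : ∀ u, ∫⁻ v in Set.Ioi (0 : ℝ), ENNReal.ofReal (u ^ (b - 1) * v ^ (b - 1)) * H (u + v) =
      ∫⁻ w, (Set.Ioi u).indicator
        (fun w => ENNReal.ofReal (u ^ (b - 1) * (w - u) ^ (b - 1)) * H w) w := by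
    intro u
    rw [← lintegral_indicator measurableSet_Ioi, ← lintegral_add_right_eq_self ((Set.Ioi u).indicator
      fun w => ENNReal.ofReal (u ^ (b - 1) * (w - u) ^ (b - 1)) * H w) u]
    congr with v
    simp [Set.indicator_apply, add_comm]
  simp_rw [hL]
  rw [← lintegral_indicator measurableSet_Ioi]
  calc _ = ∫⁻ u, ∫⁻ w, F u w := by
        congr with u
        by_cases h : 0 < u <;> simp [F, h, Set.indicator_apply]
    _ = ∫⁻ w, ∫⁻ u, F u w := lintegral_lintegral_swap hFm.aemeasurable
    _ = _ := by
        rw [← lintegral_indicator measurableSet_Ioi]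
        congr with w
        have : ∀ u, F u w = (Set.Ioo 0 w).indicator
            (fun u => ENNReal.ofReal (u ^ (b - 1) * (w - u) ^ (b - 1)) * H w) u := by
          intro u
          simp only [F, Set.indicator_apply, Set.mem_Ioi, Set.mem_Ioo]
          by_cases h1 : 0 < u <;> by_cases h2 : u < w <;> simp [h1, h2]
        simp_rw [this]
        rw [lintegral_indicator measurableSet_Ioo, lintegral_mul_const _ (by fun_prop)]
        by_cases h : 0 < w
        · rw [lintegral_Ioo_rpow_mul_sub_rpow hb h, Set.indicator_of_mem (Set.mem_Ioi.2 h)]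
        · simp [h]

theorem rieszGamma_pos {d : ℕ} {β : ℝ} (hβ : 0 < β) (hβd : β < d) : 0 < rieszGamma d β := by
  have := Real.pi_pos
  have h1 := Real.Gamma_pos_of_pos (half_pos hβ)
  have h2 := Real.Gamma_pos_of_pos (half_pos (sub_pos.2 hβd))
  unfold rieszGamma
  positivity

/-- The semigroup property `I_β ∘ I_β = I_{2β}` of the Riesz potentials, at the level of kernels and
with the exact constant. -/
theorem lintegral_riesz_kernel_mul_riesz_kernel {d : ℕ} {β : ℝ} (hβ : 0 < β) (hβd : 2 * β < d)
    {x y : EuclideanSpace ℝ (Fin d)} (hxy : x ≠ y) :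
    ∫⁻ z, ENNReal.ofReal ((‖z - x‖ ^ ((d : ℝ) - β))⁻¹ * (‖z - y‖ ^ ((d : ℝ) - β))⁻¹) =
      ENNReal.ofReal (rieszGamma d β ^ 2 / rieszGamma d (2 * β) *
        (‖x - y‖ ^ ((d : ℝ) - 2 * β))⁻¹) := by
  have hd : 0 < d := by
    have : (0 : ℝ) < d := by linarith
    exact_mod_cast this
  have : Nonempty (Fin d) := ⟨⟨0, hd⟩⟩
  set a : ℝ := ((d : ℝ) - β) / 2 with ha_def
  have ha : 0 < a := by rw [ha_def]; linarith
  have hGa := Real.Gamma_pos_of_pos ha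
  have hpi := Real.pi_pos
  set b : ℝ := β / 2 with hb_def
  have hb : 0 < b := by rw [hb_def]; linarith
  have hB := ProbabilityTheory.beta_pos hb hb
  let G : ℝ → EuclideanSpace ℝ (Fin d) → ℝ := fun u x => u ^ (-a - 1) * Real.exp (-‖x‖ ^ 2 / u)
  have hG0 : ∀ {u}, 0 < u → ∀ x, 0 ≤ G u x := fun hu x => by simp only [G]; positivity
  have hρ : ∀ z : EuclideanSpace ℝ (Fin d), z ≠ 0 →
      ∫⁻ u in Set.Ioi (0 : ℝ), ENNReal.ofReal (G u z) =
      ENNReal.ofReal (Real.Gamma a * (‖z‖ ^ ((d : ℝ) - β))⁻¹) := by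
    intro z hz
    rw [lintegral_rpow_mul_exp_neg_sq_div ha (norm_pos_iff.2 hz), show 2 * a = d - β by
      rw [ha_def]; ring]
  -- Both kernels are mixtures of Gaussians, except at `z = x` and `z = y`, where the real power takes
  -- a junk value.
  have step1 : ENNReal.ofReal (Real.Gamma a ^ 2) *
      ∫⁻ z, ENNReal.ofReal ((‖z - x‖ ^ ((d : ℝ) - β))⁻¹ * (‖z - y‖ ^ ((d : ℝ) - β))⁻¹) =
      ∫⁻ z, ∫⁻ u in Set.Ioi (0 : ℝ), ∫⁻ v in Set.Ioi (0 : ℝ),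
        ENNReal.ofReal (G u (x - z)) * ENNReal.ofReal (G v (z - y)) := by
    rw [← lintegral_const_mul' _ _ ENNReal.ofReal_ne_top]
    apply lintegral_congr_ae
    filter_upwards [Measure.ae_ne volume x, Measure.ae_ne volume y] with z hzx hzy
    have hm1 : Measurable fun u => ENNReal.ofReal (G u (x - z)) := by simp only [G]; fun_prop
    have hm2 : Measurable fun u => ENNReal.ofReal (G u (z - y)) := by simp only [G]; fun_prop
    simp_rw [lintegral_const_mul _ hm2]
    rw [lintegral_mul_const _ hm1, hρ _ (sub_ne_zero.2 hzx.symm), hρ _ (sub_ne_zero.2 hzy),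
      ← ENNReal.ofReal_mul (by positivity), ← ENNReal.ofReal_mul (by positivity), norm_sub_rev x z]
    congr 1; ring
  -- The weight `u ^ (-a - 1)` splits as `u ^ (b - 1) * u ^ (-d / 2)`, and the second factor normalises
  -- the Gaussian.
  let H : ℝ → ℝ≥0∞ := fun w => ENNReal.ofReal
    (Real.pi ^ ((d : ℝ) / 2) * (w ^ (-(d : ℝ) / 2) * Real.exp (-‖x - y‖ ^ 2 / w)))
  have step2 : ∀ u ∈ Set.Ioi (0 : ℝ), ∀ v ∈ Set.Ioi (0 : ℝ),
      ∫⁻ z, ENNReal.ofReal (G u (x - z)) * ENNReal.ofReal (G v (z - y)) =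
      ENNReal.ofReal (u ^ (b - 1) * v ^ (b - 1)) * H (u + v) := by
    intro u hu v hv
    have hu : (0 : ℝ) < u := hu
    have hv : (0 : ℝ) < v := hv
    have e : ∀ z, ENNReal.ofReal (G u (x - z)) * ENNReal.ofReal (G v (z - y)) =
        ENNReal.ofReal (u ^ (-a - 1) * v ^ (-a - 1)) *
        ENNReal.ofReal (Real.exp (-‖x - z‖ ^ 2 / u) * Real.exp (-‖z - y‖ ^ 2 / v)) := by
      intro z
      rw [← ENNReal.ofReal_mul (hG0 hu _), ← ENNReal.ofReal_mul (by positivity)]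
      congr 1
      simp only [G]; ring
    simp_rw [e]
    rw [lintegral_const_mul' _ _ ENNReal.ofReal_ne_top, lintegral_exp_mul_exp hu hv,
      ← ENNReal.ofReal_mul (by positivity), ← ENNReal.ofReal_mul (by positivity)]
    congr 1
    have hs : 0 < u + v := by positivity
    rw [Real.mul_rpow hpi.le (by positivity), Real.div_rpow (by positivity) hs.le,
      Real.mul_rpow hu.le hv.le, show b - 1 = (-a - 1) + (d : ℝ) / 2 by rw [ha_def, hb_def]; ring,
      Real.rpow_add hu, Real.rpow_add hv, neg_div (2 : ℝ) (d : ℝ), Real.rpow_neg hs.le]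
    field_simp
  have step3 : ∫⁻ z, ∫⁻ u in Set.Ioi (0 : ℝ), ∫⁻ v in Set.Ioi (0 : ℝ),
        ENNReal.ofReal (G u (x - z)) * ENNReal.ofReal (G v (z - y)) =
      ∫⁻ w in Set.Ioi (0 : ℝ), ENNReal.ofReal (ProbabilityTheory.beta b b * w ^ (2 * b - 1)) * H w := by
    have hH : Measurable H := by simp only [H]; fun_prop
    rw [← lintegral_lintegral_rpow_mul_rpow_mul_add hb hH, lintegral_lintegral_swap]
    · refine setLIntegral_congr_fun measurableSet_Ioi fun u hu => ?_
      rw [lintegral_lintegral_swap]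
      · exact setLIntegral_congr_fun measurableSet_Ioi fun v hv => step2 u hu v hv
      · simp only [G]; fun_prop
    · refine Measurable.aemeasurable ?_
      have : Measurable (Function.uncurry fun (p : EuclideanSpace ℝ (Fin d) × ℝ) (v : ℝ) =>
          ENNReal.ofReal (G p.2 (x - p.1)) * ENNReal.ofReal (G v (p.1 - y))) := by
        simp only [G]; fun_prop
      exact this.lintegral_prod_right'
  have hxy' : 0 < ‖x - y‖ := norm_pos_iff.2 (sub_ne_zero.2 hxy)
  set c : ℝ := ((d : ℝ) - 2 * β) / 2 with hc_def
  have hc : 0 < c := by rw [hc_def]; linarith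
  have hGc := Real.Gamma_pos_of_pos hc
  -- A single Gaussian mixture is left, which is the Riesz kernel of order `2 * β`.
  have step4 : ∫⁻ w in Set.Ioi (0 : ℝ),
        ENNReal.ofReal (ProbabilityTheory.beta b b * w ^ (2 * b - 1)) * H w =
      ENNReal.ofReal (ProbabilityTheory.beta b b * Real.pi ^ ((d : ℝ) / 2)) *
        ENNReal.ofReal (Real.Gamma c * (‖x - y‖ ^ ((d : ℝ) - 2 * β))⁻¹) := by
    rw [show (d : ℝ) - 2 * β = 2 * c by rw [hc_def]; ring,
      ← lintegral_rpow_mul_exp_neg_sq_div hc hxy', ← lintegral_const_mul' _ _ ENNReal.ofReal_ne_top]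
    refine setLIntegral_congr_fun measurableSet_Ioi fun w hw => ?_
    have hw : (0 : ℝ) < w := hw
    simp only [H]
    rw [← ENNReal.ofReal_mul (by positivity), ← ENNReal.ofReal_mul (by positivity),
      show -c - 1 = (2 * b - 1) + (-(d : ℝ) / 2) by rw [hc_def, hb_def]; ring, Real.rpow_add hw]
    congr 1; ring
  rw [step3, step4] at step1
  have hne : ENNReal.ofReal (Real.Gamma a ^ 2) ≠ 0 := by
    simp only [ne_eq, ENNReal.ofReal_eq_zero, not_le]; positivity
  refine (ENNReal.mul_right_inj hne ENNReal.ofReal_ne_top).1 (step1.trans ?_)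
  rw [← ENNReal.ofReal_mul (by positivity), ← ENNReal.ofReal_mul (by positivity)]
  congr 1
  have hGb := Real.Gamma_pos_of_pos hb
  have hG2b := Real.Gamma_pos_of_pos (show 0 < b + b by positivity)
  have e2 : (2 : ℝ) ^ (2 * β) = 2 ^ β * 2 ^ β := by
    rw [two_mul, Real.rpow_add (by norm_num)]
  simp only [rieszGamma, ProbabilityTheory.beta, ← ha_def, ← hb_def, ← hc_def, e2,
    show 2 * β / 2 = b + b by rw [hb_def]; ring]
  field_simp

/-! ### The `L²` seminorm as a real number -/

section MemLp

variable {𝕜 X : Type*} [RCLike 𝕜] [MeasurableSpace X] {μ : Measure X}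

theorem MeasureTheory.MemLp.toReal_eLpNorm_two_sq {f : X → 𝕜} (hf : MemLp f 2 μ) :
    (eLpNorm f 2 μ).toReal ^ 2 = ∫ x, ‖f x‖ ^ 2 ∂μ := by
  have h0 : 0 ≤ ∫ x, ‖f x‖ ^ 2 ∂μ := integral_nonneg fun x => by positivity
  rw [hf.eLpNorm_eq_integral_rpow_norm (by norm_num) (by norm_num)]
  simp only [ENNReal.toReal_ofNat, Real.rpow_ofNat]
  rw [ENNReal.toReal_ofReal (by positivity), ← Real.rpow_natCast, ← Real.rpow_mul h0]
  norm_num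

theorem MeasureTheory.MemLp.toReal_eLpNorm_le_add {f g h : X → 𝕜} (hf : MemLp f 2 μ)
    (hg : MemLp g 2 μ) (hh : ∀ᵐ x ∂μ, ‖h x‖ ≤ ‖f x + g x‖) :
    (eLpNorm h 2 μ).toReal ≤ (eLpNorm f 2 μ).toReal + (eLpNorm g 2 μ).toReal := by
  rw [← ENNReal.toReal_add hf.2.ne hg.2.ne]
  exact ENNReal.toReal_mono (ENNReal.add_lt_top.2 ⟨hf.2, hg.2⟩).ne
    ((eLpNorm_mono_ae hh).trans (eLpNorm_add_le hf.1 hg.1 (by norm_num)))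

end MemLp

/-! ### Quadratic forms of kernels that factor as squares -/

section Kernel

variable {𝕜 X Ω : Type*} [RCLike 𝕜] [MeasurableSpace X] [MeasurableSpace Ω]
  {ν : Measure X} {μ : Measure Ω} [SFinite ν] [SFinite μ] {h : Ω → X → ℝ} {K : X → X → ℝ} {c : ℝ}
  {V : X → 𝕜}

/-- Tonelli's theorem for a kernel with `c * K x y = ∫ h ω x * h ω y ∂μ`. -/
theorem lintegral_sq_lintegral_enorm_mul_eq (hc : 0 ≤ c) (hh : Measurable (Function.uncurry h))
    (hK : ∀ᵐ p ∂ν.prod ν, ∫⁻ ω, ‖h ω p.1‖ₑ * ‖h ω p.2‖ₑ ∂μ = ENNReal.ofReal (c * K p.1 p.2))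
    (hV : Measurable V) :
    ∫⁻ ω, (∫⁻ x, ‖h ω x‖ₑ * ‖V x‖ₑ ∂ν) ^ 2 ∂μ =
      ENNReal.ofReal c * ∫⁻ p, ENNReal.ofReal (K p.1 p.2) * (‖V p.1‖ₑ * ‖V p.2‖ₑ) ∂ν.prod ν := by
  have hm : ∀ ω, Measurable fun x => ‖h ω x‖ₑ * ‖V x‖ₑ := fun ω =>
    ((hh.comp (measurable_const.prodMk measurable_id)).enorm).mul hV.enorm
  have e1 : ∀ ω, (∫⁻ x, ‖h ω x‖ₑ * ‖V x‖ₑ ∂ν) ^ 2 =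
      ∫⁻ p, (‖h ω p.1‖ₑ * ‖V p.1‖ₑ) * (‖h ω p.2‖ₑ * ‖V p.2‖ₑ) ∂ν.prod ν := fun ω => by
    rw [sq, ← lintegral_prod_mul (hm ω).aemeasurable (hm ω).aemeasurable]
  have hm1 : Measurable fun q : Ω × (X × X) => ‖h q.1 q.2.1‖ₑ :=
    (hh.comp (measurable_fst.prodMk measurable_snd.fst)).enorm
  have hm2 : Measurable fun q : Ω × (X × X) => ‖h q.1 q.2.2‖ₑ :=
    (hh.comp (measurable_fst.prodMk measurable_snd.snd)).enorm
  have hV1 : Measurable fun q : Ω × (X × X) => ‖V q.2.1‖ₑ := (hV.comp measurable_snd.fst).enorm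
  have hV2 : Measurable fun q : Ω × (X × X) => ‖V q.2.2‖ₑ := (hV.comp measurable_snd.snd).enorm
  simp_rw [e1]
  rw [lintegral_lintegral_swap ((hm1.mul hV1).mul (hm2.mul hV2)).aemeasurable,
    ← lintegral_const_mul' _ _ ENNReal.ofReal_ne_top]
  apply lintegral_congr_ae
  filter_upwards [hK] with p hp
  have e2 : ∀ ω, (‖h ω p.1‖ₑ * ‖V p.1‖ₑ) * (‖h ω p.2‖ₑ * ‖V p.2‖ₑ) =
      (‖h ω p.1‖ₑ * ‖h ω p.2‖ₑ) * (‖V p.1‖ₑ * ‖V p.2‖ₑ) := fun ω => by ring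
  simp_rw [e2]
  rw [lintegral_mul_const' _ _ (by finiteness), hp, ENNReal.ofReal_mul hc, mul_assoc]

omit [SFinite μ] in
theorem lintegral_sq_lintegral_enorm_mul_add_lt_top {W : X → 𝕜}
    (hh : Measurable (Function.uncurry h)) (hV : Measurable V)
    (hV' : ∫⁻ ω, (∫⁻ x, ‖h ω x‖ₑ * ‖V x‖ₑ ∂ν) ^ 2 ∂μ < ∞)
    (hW' : ∫⁻ ω, (∫⁻ x, ‖h ω x‖ₑ * ‖W x‖ₑ ∂ν) ^ 2 ∂μ < ∞) :
    ∫⁻ ω, (∫⁻ x, ‖h ω x‖ₑ * ‖(V + W) x‖ₑ ∂ν) ^ 2 ∂μ < ∞ := by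
  have hm : Measurable fun q : Ω × X => ‖h q.1 q.2‖ₑ * ‖V q.2‖ₑ :=
    hh.enorm.mul (hV.comp measurable_snd).enorm
  have hmω : ∀ ω, Measurable fun x => ‖h ω x‖ₑ * ‖V x‖ₑ := fun ω =>
    hm.comp (measurable_const.prodMk measurable_id)
  have hmV : Measurable fun ω => (∫⁻ x, ‖h ω x‖ₑ * ‖V x‖ₑ ∂ν) ^ 2 :=
    hm.lintegral_prod_right'.pow_const 2
  have h2 := ENNReal.mul_lt_top (a := 2) (by norm_num) (ENNReal.add_lt_top.2 ⟨hV', hW'⟩)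
  rw [← lintegral_add_left hmV, ← lintegral_const_mul' _ _ (by norm_num)] at h2
  refine lt_of_le_of_lt (lintegral_mono fun ω => ?_) h2
  have hsq : ∀ a b : ℝ≥0∞, (a + b) ^ 2 ≤ 2 * (a ^ 2 + b ^ 2) := fun a b => by
    have := ENNReal.rpow_add_le_mul_rpow_add_rpow a b (p := 2) (by norm_num)
    norm_num at this
    exact_mod_cast this
  refine le_trans ?_ (hsq _ _)
  gcongr
  rw [← lintegral_add_left (hmω ω)]
  refine lintegral_mono fun x => ?_
  rw [← mul_add, Pi.add_apply]
  gcongr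
  exact enorm_add_le _ _

variable (hc : 0 ≤ c) (hh : Measurable (Function.uncurry h)) (h0 : ∀ ω x, 0 ≤ h ω x)
    (hK : ∀ᵐ p ∂ν.prod ν, ∫⁻ ω, ‖h ω p.1‖ₑ * ‖h ω p.2‖ₑ ∂μ = ENNReal.ofReal (c * K p.1 p.2))
    (hV : Measurable V)
    (hfin : ∫⁻ p, ENNReal.ofReal (K p.1 p.2) * (‖V p.1‖ₑ * ‖V p.2‖ₑ) ∂ν.prod ν < ∞)

include hc hh hK hV hfin

theorem ae_integrable_smul_of_kernel : ∀ᵐ ω ∂μ, Integrable (fun x => h ω x • V x) ν := by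
  have hfin' : ∫⁻ ω, (∫⁻ x, ‖h ω x‖ₑ * ‖V x‖ₑ ∂ν) ^ 2 ∂μ ≠ ∞ := by
    rw [lintegral_sq_lintegral_enorm_mul_eq hc hh hK hV]
    finiteness
  have hm : Measurable fun q : Ω × X => ‖h q.1 q.2‖ₑ * ‖V q.2‖ₑ :=
    hh.enorm.mul (hV.comp measurable_snd).enorm
  filter_upwards [ae_lt_top (hm.lintegral_prod_right'.pow_const 2) hfin'] with ω hω
  refine ⟨((hh.comp (measurable_const.prodMk measurable_id)).smul hV).aestronglyMeasurable, ?_⟩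
  simp_rw [HasFiniteIntegral, enorm_smul]
  exact (ENNReal.pow_lt_top_iff.1 hω).resolve_right (by norm_num)

theorem memLp_integral_smul_of_kernel : MemLp (fun ω => ∫ x, h ω x • V x ∂ν) 2 μ := by
  have hm : StronglyMeasurable fun q : Ω × X => h q.1 q.2 • V q.2 :=
    (hh.smul (hV.comp measurable_snd)).stronglyMeasurable
  refine ⟨hm.integral_prod_right'.aestronglyMeasurable, ?_⟩
  rw [eLpNorm_lt_top_iff_lintegral_rpow_enorm_lt_top (by norm_num) (by norm_num)]
  refine lt_of_le_of_lt (lintegral_mono fun ω => ?_)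
    (b := ∫⁻ ω, (∫⁻ x, ‖h ω x‖ₑ * ‖V x‖ₑ ∂ν) ^ 2 ∂μ) ?_
  · rw [← ENNReal.rpow_natCast]
    simp only [ENNReal.toReal_ofNat, Nat.cast_ofNat]
    gcongr
    refine (enorm_integral_le_lintegral_enorm _).trans_eq ?_
    simp_rw [enorm_smul]
  · rw [lintegral_sq_lintegral_enorm_mul_eq hc hh hK hV]
    finiteness

include h0 in
/-- The signed quadratic form of a kernel with `c * K x y = ∫ h ω x * h ω y ∂μ` is an integral of
squares, hence real and nonnegative. -/
theorem integral_sq_norm_integral_smul_eq (hK0 : ∀ᵐ p ∂ν.prod ν, 0 ≤ K p.1 p.2) :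
    ((∫ ω, ‖∫ x, h ω x • V x ∂ν‖ ^ 2 ∂μ : ℝ) : 𝕜) =
      c • ∫ p, K p.1 p.2 • (V p.1 * conj (V p.2)) ∂ν.prod ν := by
  let F : Ω → X × X → 𝕜 := fun ω p => (h ω p.1 • V p.1) * conj (h ω p.2 • V p.2)
  have hm1 : Measurable fun q : Ω × (X × X) => h q.1 q.2.1 • V q.2.1 :=
    (hh.comp (measurable_fst.prodMk measurable_snd.fst)).smul (hV.comp measurable_snd.fst)
  have hm2 : Measurable fun q : Ω × (X × X) => h q.1 q.2.2 • V q.2.2 :=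
    (hh.comp (measurable_fst.prodMk measurable_snd.snd)).smul (hV.comp measurable_snd.snd)
  have hFm : Measurable (Function.uncurry F) :=
    hm1.mul (RCLike.continuous_conj.measurable.comp hm2)
  have hm : ∀ ω, Measurable fun x => ‖h ω x‖ₑ * ‖V x‖ₑ := fun ω =>
    ((hh.comp (measurable_const.prodMk measurable_id)).enorm).mul hV.enorm
  have hFi : Integrable (Function.uncurry F) (μ.prod (ν.prod ν)) := by
    refine ⟨hFm.aestronglyMeasurable, ?_⟩
    rw [HasFiniteIntegral, lintegral_prod _ hFm.enorm.aemeasurable]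
    refine lt_of_eq_of_lt (b := ∫⁻ ω, (∫⁻ x, ‖h ω x‖ₑ * ‖V x‖ₑ ∂ν) ^ 2 ∂μ)
      (lintegral_congr fun ω => ?_) ?_
    · rw [sq, ← lintegral_prod_mul (hm ω).aemeasurable (hm ω).aemeasurable]
      simp only [Function.uncurry, F, enorm_mul, enorm_smul, RCLike.enorm_conj]
    · rw [lintegral_sq_lintegral_enorm_mul_eq hc hh hK hV]
      finiteness
  have e1 : ∀ ω, ∫ p, F ω p ∂ν.prod ν = ((‖∫ x, h ω x • V x ∂ν‖ ^ 2 : ℝ) : 𝕜) := fun ω => by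
    simp only [F]
    rw [integral_prod_mul (fun x => h ω x • V x) (fun x => conj (h ω x • V x)), integral_conj,
      RCLike.mul_conj]
    norm_cast
  rw [← integral_ofReal]
  simp_rw [← e1]
  rw [integral_integral_swap hFi, ← integral_smul]
  apply integral_congr_ae
  filter_upwards [hK, hK0] with p hp hp0
  have e2 : ∀ ω, F ω p = (h ω p.1 * h ω p.2) • (V p.1 * conj (V p.2)) := fun ω => by
    simp only [F, RCLike.real_smul_eq_coe_mul, map_mul, RCLike.conj_ofReal]
    ring
  simp_rw [e2]
  rw [integral_smul_const, smul_smul]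
  congr 1
  have hmp : ∀ x, Measurable fun ω => h ω x := fun x =>
    hh.comp (measurable_id.prodMk measurable_const)
  rw [integral_eq_lintegral_of_nonneg_ae
    (Filter.Eventually.of_forall fun ω => mul_nonneg (h0 _ _) (h0 _ _))
    ((hmp _).mul (hmp _)).aestronglyMeasurable]
  simp_rw [← Real.enorm_of_nonneg (mul_nonneg (h0 _ p.1) (h0 _ p.2)), enorm_mul]
  rw [hp, ENNReal.toReal_ofReal (mul_nonneg hc hp0)]

end Kernel

/-! ### The power kernel as a mixture of indicators of balls -/

section Balls

open Metric

variable {d : ℕ}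

/-- The volume of the intersection of two balls scales under the similarity `z ↦ x + ρ • L z`. -/
theorem volume_closedBall_inter_closedBall_smul_isometry {ρ : ℝ} (hρ : 0 < ρ)
    (L : EuclideanSpace ℝ (Fin d) ≃ₗᵢ[ℝ] EuclideanSpace ℝ (Fin d)) (x v : EuclideanSpace ℝ (Fin d))
    (r : ℝ) :
    volume (closedBall x (ρ * r) ∩ closedBall (x + ρ • L v) (ρ * r)) =
      ENNReal.ofReal (ρ ^ d) * volume (closedBall 0 r ∩ closedBall v r) := by
  have h1 : closedBall x (ρ * r) ∩ closedBall (x + ρ • L v) (ρ * r) =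
      (fun z => -x + z) ⁻¹' (ρ • (L.symm ⁻¹' (closedBall 0 r ∩ closedBall v r))) := by
    ext z
    rw [Set.mem_preimage, Set.mem_smul_set_iff_inv_smul_mem₀ hρ.ne', Set.mem_preimage,
      Set.mem_inter_iff, Set.mem_inter_iff]
    simp only [mem_closedBall, dist_eq_norm]
    have e1 : ‖L.symm (ρ⁻¹ • (-x + z)) - 0‖ = ρ⁻¹ * ‖z - x‖ := by
      rw [sub_zero, LinearIsometryEquiv.norm_map, norm_smul, Real.norm_of_nonneg (by positivity),
        neg_add_eq_sub]
    have e2 : ‖L.symm (ρ⁻¹ • (-x + z)) - v‖ = ρ⁻¹ * ‖z - (x + ρ • L v)‖ := by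
      have : L.symm (ρ⁻¹ • (-x + z)) - v = L.symm (ρ⁻¹ • (z - (x + ρ • L v))) := by
        rw [sub_eq_iff_eq_add', ← L.symm_apply_apply v, ← map_add, L.apply_symm_apply, smul_sub,
          smul_add ρ⁻¹ x, smul_smul, inv_mul_cancel₀ hρ.ne', one_smul, smul_add, smul_neg]
        congr 1
        abel
      rw [this, LinearIsometryEquiv.norm_map, norm_smul, Real.norm_of_nonneg (by positivity)]
    rw [e1, e2, inv_mul_le_iff₀ hρ, inv_mul_le_iff₀ hρ]
  rw [h1, measure_preimage_add, Measure.addHaar_smul, finrank_euclideanSpace, Fintype.card_fin,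
    abs_of_pos (by positivity), L.symm.measurePreserving.measure_preimage
      (measurableSet_closedBall.inter measurableSet_closedBall).nullMeasurableSet]

theorem exists_eq_norm_smul_isometry {e : EuclideanSpace ℝ (Fin d)} (he : ‖e‖ = 1)
    (w : EuclideanSpace ℝ (Fin d)) :
    ∃ L : EuclideanSpace ℝ (Fin d) ≃ₗᵢ[ℝ] EuclideanSpace ℝ (Fin d), w = ‖w‖ • L e := by
  by_cases hw : w = 0
  · exact ⟨LinearIsometryEquiv.refl ℝ _, by simp [hw]⟩
  have hw' : ‖w‖ ≠ 0 := norm_ne_zero_iff.2 hw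
  have hn : ‖e‖ = ‖‖w‖⁻¹ • w‖ := by
    rw [he, norm_smul, norm_inv, norm_norm, inv_mul_cancel₀ hw']
  refine ⟨Submodule.reflection (ℝ ∙ (e - ‖w‖⁻¹ • w))ᗮ, ?_⟩
  rw [Submodule.reflection_sub hn, smul_smul, mul_inv_cancel₀ hw', one_smul]

/-- The integral converges at `0` since balls of radius less than `1 / 2` around points at distance
`1` are disjoint, and at `∞` since `lam > 0`. -/
theorem lintegral_rpow_mul_volume_inter_lt_top {lam : ℝ} (hl : 0 < lam)
    {e : EuclideanSpace ℝ (Fin d)} (he : ‖e‖ = 1) :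
    ∫⁻ r in Set.Ioi (0 : ℝ), ENNReal.ofReal (r ^ (-(lam + d + 1))) *
      volume (closedBall 0 r ∩ closedBall e r) < ∞ := by
  have hI : IntegrableOn (fun r : ℝ => r ^ (-(lam + 1))) (Set.Ioi (1 / 4)) :=
    integrableOn_Ioi_rpow_of_lt (by linarith) (by norm_num)
  have hI' : ∫⁻ r in Set.Ioi (1 / 4 : ℝ), ENNReal.ofReal (r ^ (-(lam + 1))) < ∞ :=
    hI.lintegral_lt_top
  have hvol : volume (closedBall (0 : EuclideanSpace ℝ (Fin d)) 1) < ∞ := measure_closedBall_lt_top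
  refine lt_of_le_of_lt ?_ (ENNReal.mul_lt_top hI' hvol)
  rw [← lintegral_mul_const' _ _ hvol.ne, ← lintegral_indicator measurableSet_Ioi,
    ← lintegral_indicator measurableSet_Ioi]
  refine lintegral_mono fun r => ?_
  by_cases hr : 0 < r
  swap
  · simp [hr]
  rw [Set.indicator_of_mem (Set.mem_Ioi.2 hr)]
  by_cases hr4 : 1 / 4 < r
  · rw [Set.indicator_of_mem (Set.mem_Ioi.2 hr4)]
    calc _ ≤ ENNReal.ofReal (r ^ (-(lam + d + 1))) *
          (ENNReal.ofReal (r ^ d) * volume (closedBall (0 : EuclideanSpace ℝ (Fin d)) 1)) := by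
          gcongr
          refine (measure_mono Set.inter_subset_left).trans_eq ?_
          rw [Measure.addHaar_closedBall' _ _ hr.le, finrank_euclideanSpace, Fintype.card_fin]
      _ = _ := by
          rw [← mul_assoc, ← ENNReal.ofReal_mul (by positivity), ← Real.rpow_natCast,
            ← Real.rpow_add hr]
          congr 3
          ring
  · have : closedBall (0 : EuclideanSpace ℝ (Fin d)) r ∩ closedBall e r = ∅ := by
      refine (closedBall_disjoint_closedBall ?_).inter_eq
      rw [dist_zero_left, he]
      linarith
    simp [this]

/-- The weighted indicator `r ^ (-s) * 1_{B(z, r)}(x)` of the closed ball with `ω = (r, z)`. The pair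
`ω` is a parameter, integrated over `(0, ∞) × ℝ^d`; for `r < 0` the ball is empty and the value is
`0`. -/
noncomputable def ballKernel (s : ℝ) (ω : ℝ × EuclideanSpace ℝ (Fin d))
    (x : EuclideanSpace ℝ (Fin d)) : ℝ :=
  (closedBall ω.2 ω.1).indicator (fun _ => ω.1 ^ (-s)) x

theorem ballKernel_nonneg (s : ℝ) (ω : ℝ × EuclideanSpace ℝ (Fin d))
    (x : EuclideanSpace ℝ (Fin d)) : 0 ≤ ballKernel s ω x := by
  exact Set.indicator_apply_nonneg fun hx => Real.rpow_nonneg (nonempty_closedBall.1 ⟨x, hx⟩) _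

theorem measurable_ballKernel (s : ℝ) : Measurable (Function.uncurry (ballKernel (d := d) s)) := by
  have : Function.uncurry (ballKernel (d := d) s) =
      ({p : (ℝ × EuclideanSpace ℝ (Fin d)) × EuclideanSpace ℝ (Fin d) |
        dist p.2 p.1.2 ≤ p.1.1}).indicator (fun p => p.1.1 ^ (-s)) := by
    classical
    ext p
    simp [Function.uncurry, ballKernel, Set.indicator_apply]
  rw [this]
  exact Measurable.indicator (by fun_prop)
    (measurableSet_le (by fun_prop) (by fun_prop))

/-- A power of the distance is a mixture of products of indicators of balls. The mixture depends only
on `‖x - y‖` by isometry invariance, and the substitution `r = ‖x - y‖ * s` shows that it is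
homogeneous of degree `-lam`. The weight `r ^ (-(lam + d + 1))` is shared equally by the two factors. -/
theorem exists_lintegral_ballKernel_mul_ballKernel (hd : 0 < d) {lam : ℝ} (hl : 0 < lam) :
    ∃ C : ℝ, 0 ≤ C ∧ ∀ x y : EuclideanSpace ℝ (Fin d), x ≠ y →
      ∫⁻ ω, ‖ballKernel ((lam + d + 1) / 2) ω x‖ₑ * ‖ballKernel ((lam + d + 1) / 2) ω y‖ₑ
        ∂((volume.restrict (Set.Ioi (0 : ℝ))).prod volume) =
      ENNReal.ofReal (C * ‖x - y‖ ^ (-lam)) := by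
  have : Nonempty (Fin d) := ⟨⟨0, hd⟩⟩
  obtain ⟨e, he⟩ := exists_norm_eq (EuclideanSpace ℝ (Fin d)) zero_le_one
  have hC := lintegral_rpow_mul_volume_inter_lt_top hl he
  set C := ∫⁻ r in Set.Ioi (0 : ℝ), ENNReal.ofReal (r ^ (-(lam + d + 1))) *
      volume (closedBall 0 r ∩ closedBall e r) with hC_def
  refine ⟨C.toReal, ENNReal.toReal_nonneg, fun x y hxy => ?_⟩
  set s := (lam + d + 1) / 2 with hs
  have hρ : 0 < ‖y - x‖ := norm_pos_iff.2 (sub_ne_zero.2 hxy.symm)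
  obtain ⟨L, hL⟩ := exists_eq_norm_smul_isometry he (y - x)
  have hm : Measurable fun ω : ℝ × EuclideanSpace ℝ (Fin d) =>
      ‖ballKernel s ω x‖ₑ * ‖ballKernel s ω y‖ₑ :=
    ((measurable_ballKernel s).comp (measurable_id.prodMk measurable_const)).enorm.mul
      ((measurable_ballKernel s).comp (measurable_id.prodMk measurable_const)).enorm
  rw [lintegral_prod _ hm.aemeasurable]
  have e1 : ∀ r ∈ Set.Ioi (0 : ℝ), ∫⁻ z, ‖ballKernel s (r, z) x‖ₑ * ‖ballKernel s (r, z) y‖ₑ =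
      ENNReal.ofReal (r ^ (-(lam + d + 1))) * volume (closedBall x r ∩ closedBall y r) := by
    intro r hr
    have hr : (0 : ℝ) < r := hr
    have : ∀ z, ‖ballKernel s (r, z) x‖ₑ * ‖ballKernel s (r, z) y‖ₑ =
        (closedBall x r ∩ closedBall y r).indicator
          (fun _ => ENNReal.ofReal (r ^ (-(lam + d + 1)))) z := by
      classical
      intro z
      simp only [ballKernel, Set.indicator_apply, mem_closedBall, Set.mem_inter_iff,
        dist_comm z]
      by_cases h1 : dist x z ≤ r <;> by_cases h2 : dist y z ≤ r <;> simp only [h1, h2] <;> simp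
      rw [Real.enorm_of_nonneg (by positivity), ← ENNReal.ofReal_mul (by positivity),
        ← Real.rpow_add hr]
      congr 2
      rw [hs]; ring
    simp_rw [this]
    rw [lintegral_indicator (measurableSet_closedBall.inter measurableSet_closedBall),
      setLIntegral_const]
  rw [setLIntegral_congr_fun measurableSet_Ioi e1, ← image_const_mul_Ioi_zero hρ,
    lintegral_image_const_mul hρ measurableSet_Ioi]
  have e2 : ∀ r ∈ Set.Ioi (0 : ℝ), ENNReal.ofReal ((‖y - x‖ * r) ^ (-(lam + d + 1))) *
      volume (closedBall x (‖y - x‖ * r) ∩ closedBall y (‖y - x‖ * r)) =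
      ENNReal.ofReal (‖y - x‖ ^ (-(lam + 1))) * (ENNReal.ofReal (r ^ (-(lam + d + 1))) *
      volume (closedBall 0 r ∩ closedBall e r)) := by
    intro r hr
    have hr : (0 : ℝ) < r := hr
    have hy : y = x + ‖y - x‖ • L e := by rw [← hL]; abel
    have := volume_closedBall_inter_closedBall_smul_isometry hρ L x e r
    rw [← hy] at this
    rw [this, Real.mul_rpow hρ.le hr.le, ← mul_assoc, ← mul_assoc,
      ← ENNReal.ofReal_mul (by positivity), ← ENNReal.ofReal_mul (by positivity),
      show -(lam + 1) = -(lam + d + 1) + (d : ℝ) by ring, Real.rpow_add hρ, Real.rpow_natCast]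
    congr 2
    ring
  rw [setLIntegral_congr_fun measurableSet_Ioi e2, lintegral_const_mul' _ _ ENNReal.ofReal_ne_top,
    ← hC_def, ← mul_assoc, ← ENNReal.ofReal_mul hρ.le, ENNReal.ofReal_mul ENNReal.toReal_nonneg,
    ENNReal.ofReal_toReal hC.ne, mul_comm, norm_sub_rev x y,
    show -lam = 1 + -(lam + 1) by ring, Real.rpow_add hρ, Real.rpow_one]

/-- A function whose integrals over almost all balls vanish is zero, by Lebesgue's differentiation
theorem along a sequence of good radii tending to `0`. -/
theorem ae_eq_zero_of_integral_ballKernel_smul_eq_zero {𝕜 : Type*} [RCLike 𝕜] {s : ℝ}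
    {V : EuclideanSpace ℝ (Fin d) → 𝕜} (hV : LocallyIntegrable V)
    (h : ∀ᵐ ω ∂((volume.restrict (Set.Ioi (0 : ℝ))).prod
      (volume : Measure (EuclideanSpace ℝ (Fin d)))), ∫ x, ballKernel s ω x • V x = 0) :
    V =ᵐ[volume] 0 := by
  have h1 : ∀ᵐ r : ℝ, r ∈ Set.Ioi (0 : ℝ) → ∀ᵐ z : EuclideanSpace ℝ (Fin d),
      ∫ x in closedBall z r, V x = 0 := by
    rw [← ae_restrict_iff' measurableSet_Ioi]
    filter_upwards [Measure.ae_ae_of_ae_prod h, ae_restrict_mem measurableSet_Ioi] with r hr hr0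
    have hr0 : (0 : ℝ) < r := hr0
    filter_upwards [hr] with z hz
    have e : ∀ x, ballKernel s (r, z) x • V x =
        (closedBall z r).indicator (fun x => r ^ (-s) • V x) x := fun x => by
      by_cases hx : x ∈ closedBall z r <;> simp only [ballKernel, Set.indicator, hx] <;> simp
    simp_rw [e] at hz
    rw [integral_indicator measurableSet_closedBall, integral_smul] at hz
    exact (smul_eq_zero.1 hz).resolve_left (by positivity)
  have h2 : ∀ n : ℕ, ∃ r ∈ Set.Ioo (0 : ℝ) (1 / (n + 1)), ∀ᵐ z : EuclideanSpace ℝ (Fin d),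
      ∫ x in closedBall z r, V x = 0 := by
    intro n
    have hn : (0 : ℝ) < 1 / (n + 1) := by positivity
    have : (ae (volume.restrict (Set.Ioo (0 : ℝ) (1 / (n + 1))))).NeBot := by
      rw [ae_neBot, ne_eq, Measure.restrict_eq_zero, Real.volume_Ioo, ENNReal.ofReal_eq_zero]
      linarith
    obtain ⟨r, hr, hr'⟩ := ((ae_restrict_mem measurableSet_Ioo).and (ae_restrict_of_ae h1)).exists
      (f := ae (volume.restrict (Set.Ioo (0 : ℝ) (1 / (n + 1)))))
    exact ⟨r, hr, hr' hr.1⟩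
  choose r hr hrz using h2
  have hlim : Filter.Tendsto r Filter.atTop (nhdsWithin 0 (Set.Ioi 0)) := by
    refine tendsto_nhdsWithin_iff.2 ⟨?_, Filter.Eventually.of_forall fun n => (hr n).1⟩
    exact squeeze_zero (fun n => (hr n).1.le) (fun n => (hr n).2.le)
      tendsto_one_div_add_atTop_nhds_zero_nat
  filter_upwards [ae_all_iff.2 hrz,
    IsUnifLocDoublingMeasure.ae_tendsto_average volume hV 1] with z hz hav
  have := hav (fun _ => z) r hlim
    (Filter.Eventually.of_forall fun n => mem_closedBall_self (by linarith [(hr n).1]))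
  simp_rw [setAverage_eq, hz, smul_zero] at this
  exact (tendsto_nhds_unique this tendsto_const_nhds)

end Balls

/-! ### The Rollnik integrals -/

section Rollnik

variable {𝕜 : Type*} [RCLike 𝕜] {d : ℕ} {α : ℝ}

/-- The Rollnik integral over the product space. The two integrands agree even on the
diagonal, because `0 ^ (-s) = (0 ^ s)⁻¹` holds for every real `s`. -/
theorem rollnikIntegral_eq_lintegral_prod {V : EuclideanSpace ℝ (Fin d) → 𝕜} (hV : Measurable V) :
    rollnikIntegral α V = ∫⁻ p : EuclideanSpace ℝ (Fin d) × EuclideanSpace ℝ (Fin d),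
      ENNReal.ofReal (‖p.1 - p.2‖ ^ (2 * α - 2 * (d : ℝ))) * (‖V p.1‖ₑ * ‖V p.2‖ₑ)
        ∂volume.prod volume := by
  have h1 : Measurable fun p : EuclideanSpace ℝ (Fin d) × EuclideanSpace ℝ (Fin d) =>
      ‖V p.1‖ₑ * ‖V p.2‖ₑ := (hV.comp measurable_fst).enorm.mul (hV.comp measurable_snd).enorm
  have h2 : Measurable fun p : EuclideanSpace ℝ (Fin d) × EuclideanSpace ℝ (Fin d) =>
      ENNReal.ofReal (‖p.1 - p.2‖ ^ (2 * α - 2 * (d : ℝ))) := by fun_prop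
  have h3 := h2.mul h1
  simp only [Pi.mul_def] at h3
  rw [lintegral_prod _ h3.aemeasurable]
  unfold rollnikIntegral
  congr with x
  congr with y
  rw [show 2 * α - 2 * (d : ℝ) = -(2 * ((d : ℝ) - α)) by ring, Real.rpow_neg (norm_nonneg _),
    div_eq_inv_mul, ENNReal.ofReal_mul (by positivity), ENNReal.ofReal_mul (norm_nonneg _),
    ofReal_norm, ofReal_norm]

theorem rollnikIntegral_congr {V W : EuclideanSpace ℝ (Fin d) → 𝕜} (h : V =ᵐ[volume] W) :
    rollnikIntegral α V = rollnikIntegral α W := by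
  unfold rollnikIntegral
  apply lintegral_congr_ae
  filter_upwards [h] with x hx
  apply lintegral_congr_ae
  filter_upwards [h] with y hy
  rw [hx, hy]

theorem rollnikIntegral_norm (V : EuclideanSpace ℝ (Fin d) → 𝕜) :
    rollnikIntegral α (fun x => ‖V x‖) = rollnikIntegral α V := by
  simp only [rollnikIntegral, norm_norm]

theorem rieszPotential_congr {β : ℝ} {V W : EuclideanSpace ℝ (Fin d) → 𝕜} (h : V =ᵐ[volume] W) :
    rieszPotential β V = rieszPotential β W := by
  ext x
  unfold rieszPotential
  congr 1
  apply integral_congr_ae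
  filter_upwards [h] with y hy
  rw [hy]

theorem rieszPotential_const_smul {β : ℝ} (c : 𝕜) (V : EuclideanSpace ℝ (Fin d) → 𝕜) :
    rieszPotential β (c • V) = c • rieszPotential β V := by
  ext x
  simp only [rieszPotential, Pi.smul_apply]
  simp_rw [smul_comm _ c]
  rw [integral_smul, smul_comm]

theorem norm_rieszPotential_norm_add_le {β : ℝ} {f g : EuclideanSpace ℝ (Fin d) → 𝕜}
    {x : EuclideanSpace ℝ (Fin d)}
    (hf : Integrable fun y => (‖x - y‖ ^ ((d : ℝ) - β))⁻¹ • ‖f y‖)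
    (hg : Integrable fun y => (‖x - y‖ ^ ((d : ℝ) - β))⁻¹ • ‖g y‖) :
    ‖rieszPotential β (fun y => ‖f y + g y‖) x‖ ≤
      ‖rieszPotential β (fun y => ‖f y‖) x + rieszPotential β (fun y => ‖g y‖) x‖ := by
  have hk : ∀ y, 0 ≤ (‖x - y‖ ^ ((d : ℝ) - β))⁻¹ := fun y => by positivity
  simp only [rieszPotential]
  rw [← smul_add, ← integral_add hf hg, norm_smul, norm_smul]
  refine mul_le_mul_of_nonneg_left ?_ (norm_nonneg _)
  rw [Real.norm_of_nonneg (integral_nonneg fun y => smul_nonneg (hk y) (norm_nonneg _)),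
    Real.norm_of_nonneg (integral_nonneg fun y => add_nonneg
      (smul_nonneg (hk y) (norm_nonneg _)) (smul_nonneg (hk y) (norm_nonneg _)))]
  refine integral_mono_of_nonneg
    (Filter.Eventually.of_forall fun y => smul_nonneg (hk y) (norm_nonneg _)) (hf.add hg)
    (Filter.Eventually.of_forall fun y => ?_)
  beta_reduce
  rw [← smul_add]
  exact smul_le_smul_of_nonneg_left (norm_add_le _ _) (hk y)

theorem measurable_riesz_kernel (β : ℝ) :
    Measurable (Function.uncurry fun z x : EuclideanSpace ℝ (Fin d) =>
      (‖z - x‖ ^ ((d : ℝ) - β))⁻¹) := by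
  unfold Function.uncurry
  fun_prop

/-- The diagonal is a null set; off it the real powers of `‖x - y‖` take their true values. -/
theorem ae_prod_ne (hd : 0 < d) :
    ∀ᵐ p : EuclideanSpace ℝ (Fin d) × EuclideanSpace ℝ (Fin d) ∂volume.prod volume, p.1 ≠ p.2 := by
  have : Nonempty (Fin d) := ⟨⟨0, hd⟩⟩
  have hs : MeasurableSet {p : EuclideanSpace ℝ (Fin d) × EuclideanSpace ℝ (Fin d) | p.1 ≠ p.2} :=
    (isClosed_diagonal.measurableSet).compl
  rw [Measure.ae_prod_iff_ae_ae hs]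
  refine Filter.Eventually.of_forall fun x => ?_
  filter_upwards [Measure.ae_ne volume x] with y hy using hy.symm

section SignedIntegral

variable {V : EuclideanSpace ℝ (Fin d) → 𝕜} (hV : Measurable V) (hfin : rollnikIntegral α V < ∞)
include hV hfin

theorem integrable_rollnikSignedIntegrand :
    Integrable (fun p : EuclideanSpace ℝ (Fin d) × EuclideanSpace ℝ (Fin d) =>
      rollnikSignedIntegrand α V p.1 p.2) (volume.prod volume) := by
  rw [rollnikIntegral_eq_lintegral_prod hV] at hfin
  refine ⟨Measurable.aestronglyMeasurable ?_, ?_⟩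
  · refine Measurable.smul (by fun_prop) ?_
    exact (hV.comp measurable_fst).mul
      (RCLike.continuous_conj.measurable.comp (hV.comp measurable_snd))
  · refine lt_of_eq_of_lt (lintegral_congr fun p => ?_) hfin
    simp only [rollnikSignedIntegrand]
    rw [enorm_smul, enorm_mul, RCLike.enorm_conj,
      Real.enorm_of_nonneg (by positivity)]

theorem rollnikSignedIntegral_eq_integral_prod :
    rollnikSignedIntegral α V = ∫ p : EuclideanSpace ℝ (Fin d) × EuclideanSpace ℝ (Fin d),
      ‖p.1 - p.2‖ ^ (2 * α - 2 * (d : ℝ)) • (V p.1 * conj (V p.2)) ∂volume.prod volume :=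
  (integral_prod _ (integrable_rollnikSignedIntegrand hV hfin)).symm

/-- For `|V|` the signed integral is the absolute one, so that identities for the signed integral yield
those for the absolute one. -/
theorem rollnikSignedIntegral_norm :
    rollnikSignedIntegral α (fun x => ‖V x‖) = (rollnikIntegral α V).toReal := by
  have hV' : Measurable fun x => ‖V x‖ := hV.norm
  rw [← rollnikIntegral_norm] at hfin ⊢
  rw [rollnikSignedIntegral_eq_integral_prod hV' hfin, rollnikIntegral_eq_lintegral_prod hV',
    integral_eq_lintegral_of_nonneg_ae
      (Filter.Eventually.of_forall fun p => by simp only [Pi.zero_apply]; simp; positivity)]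
  · congr 2 with p
    simp only [conj_trivial, smul_eq_mul]
    rw [ENNReal.ofReal_mul (by positivity), ENNReal.ofReal_mul (by positivity),
      Real.enorm_of_nonneg (norm_nonneg _), Real.enorm_of_nonneg (norm_nonneg _)]
  · exact (integrable_rollnikSignedIntegrand hV' hfin).aestronglyMeasurable

end SignedIntegral

theorem zero_mem_rollnikClass : (0 : EuclideanSpace ℝ (Fin d) →ₘ[volume] 𝕜) ∈
    rollnikClass 𝕜 d α := by
  have : rollnikIntegral α (0 : EuclideanSpace ℝ (Fin d) → 𝕜) < ∞ := by simp [rollnikIntegral]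
  rwa [← rollnikIntegral_congr AEEqFun.coeFn_zero] at this

theorem norm_rollnikSignedIntegral_le {V : EuclideanSpace ℝ (Fin d) →ₘ[volume] 𝕜}
    (hV : V ∈ rollnikClass 𝕜 d α) :
    ‖rollnikSignedIntegral α V‖ ≤ (rollnikIntegral α V).toReal := by
  rw [rollnikSignedIntegral_eq_integral_prod V.measurable hV,
    ← rollnikSignedIntegral_norm V.measurable hV, rollnikSignedIntegral_eq_integral_prod
      V.measurable.norm (by rwa [rollnikIntegral_norm])]
  refine (norm_integral_le_integral_norm _).trans_eq (integral_congr_ae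
    (Filter.Eventually.of_forall fun p => ?_))
  simp only [norm_smul, norm_mul, RCLike.norm_conj, conj_trivial, smul_eq_mul]
  rw [Real.norm_of_nonneg (by positivity)]

theorem rollnikSignedNorm_le_rollnikNorm {V : EuclideanSpace ℝ (Fin d) →ₘ[volume] 𝕜}
    (hV : V ∈ rollnikClass 𝕜 d α) :
    rollnikSignedNorm α V ≤ rollnikNorm α V :=
  Real.sqrt_le_sqrt ((RCLike.re_le_norm _).trans (norm_rollnikSignedIntegral_le hV))

/-- The condition `α < d < 2α`, under which both Riesz potentials, of the order `β = α - d / 2` and of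
the order `2β = 2α - d`, are defined. -/
structure RollnikExponent (d : ℕ) (α : ℝ) : Prop where
  lt : α < (d : ℝ)
  lt_two_mul : (d : ℝ) < 2 * α

namespace RollnikExponent

variable (hα : RollnikExponent d α)
include hα

theorem order_pos : 0 < α - (d : ℝ) / 2 := by linarith [hα.lt_two_mul]

theorem two_mul_order_lt : 2 * (α - (d : ℝ) / 2) < d := by linarith [hα.lt]

theorem dim_pos : 0 < d := by
  have : (0 : ℝ) < d := by linarith [hα.lt, hα.lt_two_mul]
  exact_mod_cast this

theorem rieszGamma_order_pos : 0 < rieszGamma d (α - (d : ℝ) / 2) :=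
  rieszGamma_pos hα.order_pos (by linarith [hα.two_mul_order_lt, hα.order_pos])

theorem rieszGamma_two_mul_order_pos : 0 < rieszGamma d (2 * α - (d : ℝ)) :=
  rieszGamma_pos (by linarith [hα.lt_two_mul]) (by linarith [hα.lt])

/-- The constant of the composition formula for `β = α - d / 2` and `2β = 2α - d`. -/
theorem const_pos : 0 < rieszGamma d (α - (d : ℝ) / 2) ^ 2 / rieszGamma d (2 * α - (d : ℝ)) :=
  div_pos (pow_pos hα.rieszGamma_order_pos 2) hα.rieszGamma_two_mul_order_pos

theorem ae_lintegral_riesz_kernel :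
    ∀ᵐ p : EuclideanSpace ℝ (Fin d) × EuclideanSpace ℝ (Fin d) ∂volume.prod volume,
      ∫⁻ z, ‖(‖z - p.1‖ ^ ((d : ℝ) - (α - (d : ℝ) / 2)))⁻¹‖ₑ *
        ‖(‖z - p.2‖ ^ ((d : ℝ) - (α - (d : ℝ) / 2)))⁻¹‖ₑ =
      ENNReal.ofReal (rieszGamma d (α - (d : ℝ) / 2) ^ 2 / rieszGamma d (2 * α - (d : ℝ)) *
        ‖p.1 - p.2‖ ^ (2 * α - 2 * (d : ℝ))) := by
  filter_upwards [ae_prod_ne hα.dim_pos] with p hp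
  have := lintegral_riesz_kernel_mul_riesz_kernel hα.order_pos hα.two_mul_order_lt hp
  rw [show 2 * (α - (d : ℝ) / 2) = 2 * α - d by ring, ← Real.rpow_neg (norm_nonneg _),
    show -((d : ℝ) - (2 * α - d)) = 2 * α - 2 * d by ring] at this
  rw [← this]
  congr with z
  rw [Real.enorm_of_nonneg (by positivity), Real.enorm_of_nonneg (by positivity),
    ← ENNReal.ofReal_mul (by positivity)]

theorem ofReal_mul_rollnikIntegral {V : EuclideanSpace ℝ (Fin d) → 𝕜} (hV : Measurable V) :
    ENNReal.ofReal (rieszGamma d (α - (d : ℝ) / 2) ^ 2 / rieszGamma d (2 * α - (d : ℝ))) *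
        rollnikIntegral α V =
      ∫⁻ z : EuclideanSpace ℝ (Fin d), (∫⁻ x,
        ‖(‖z - x‖ ^ ((d : ℝ) - (α - (d : ℝ) / 2)))⁻¹‖ₑ * ‖V x‖ₑ) ^ 2 := by
  rw [rollnikIntegral_eq_lintegral_prod hV]
  exact (lintegral_sq_lintegral_enorm_mul_eq (K := fun x y => ‖x - y‖ ^ (2 * α - 2 * (d : ℝ)))
    hα.const_pos.le (measurable_riesz_kernel _)
    hα.ae_lintegral_riesz_kernel hV).symm

/-- Finiteness of the Rollnik integral is square integrability of the potential of `|V|`, a condition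
that is visibly stable under sums and scalar multiples. -/
theorem rollnikIntegral_lt_top_iff {V : EuclideanSpace ℝ (Fin d) → 𝕜} (hV : Measurable V) :
    rollnikIntegral α V < ∞ ↔ ∫⁻ z : EuclideanSpace ℝ (Fin d), (∫⁻ x,
        ‖(‖z - x‖ ^ ((d : ℝ) - (α - (d : ℝ) / 2)))⁻¹‖ₑ * ‖V x‖ₑ) ^ 2 < ∞ := by
  rw [← hα.ofReal_mul_rollnikIntegral hV]
  have h0 := ENNReal.ofReal_pos.2 hα.const_pos
  constructor
  · intro h
    finiteness
  · intro h
    rw [ENNReal.mul_lt_top_iff] at h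
    rcases h with h | h | h
    · exact h.2
    · exact absurd h h0.ne'
    · simp [h]

theorem rollnikIntegral_add_lt_top {V W : EuclideanSpace ℝ (Fin d) → 𝕜} (hV : Measurable V)
    (hW : Measurable W) (hV' : rollnikIntegral α V < ∞) (hW' : rollnikIntegral α W < ∞) :
    rollnikIntegral α (V + W) < ∞ := by
  rw [hα.rollnikIntegral_lt_top_iff hV] at hV'
  rw [hα.rollnikIntegral_lt_top_iff hW] at hW'
  rw [hα.rollnikIntegral_lt_top_iff (hV.add hW)]
  exact lintegral_sq_lintegral_enorm_mul_add_lt_top (measurable_riesz_kernel _) hV hV' hW'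

theorem rollnikIntegral_const_smul_lt_top (c : 𝕜) {V : EuclideanSpace ℝ (Fin d) → 𝕜}
    (hV : Measurable V) (hV' : rollnikIntegral α V < ∞) : rollnikIntegral α (c • V) < ∞ := by
  rw [hα.rollnikIntegral_lt_top_iff hV] at hV'
  rw [hα.rollnikIntegral_lt_top_iff (hV.const_smul c)]
  have : ∀ z : EuclideanSpace ℝ (Fin d),
      (∫⁻ x, ‖(‖z - x‖ ^ ((d : ℝ) - (α - (d : ℝ) / 2)))⁻¹‖ₑ * ‖(c • V) x‖ₑ) ^ 2 =
      ‖c‖ₑ ^ 2 * (∫⁻ x, ‖(‖z - x‖ ^ ((d : ℝ) - (α - (d : ℝ) / 2)))⁻¹‖ₑ * ‖V x‖ₑ) ^ 2 := by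
    intro z
    rw [← mul_pow, ← lintegral_const_mul' _ _ (by finiteness)]
    congr with x
    rw [Pi.smul_apply, enorm_smul, mul_left_comm]
  simp_rw [this]
  rw [lintegral_const_mul' _ _ (by finiteness)]
  finiteness

variable {V : EuclideanSpace ℝ (Fin d) → 𝕜} (hV : Measurable V) (hfin : rollnikIntegral α V < ∞)
include hV hfin

theorem ae_integrable_riesz : ∀ᵐ x : EuclideanSpace ℝ (Fin d),
    Integrable (fun y => (‖x - y‖ ^ ((d : ℝ) - (α - (d : ℝ) / 2)))⁻¹ • V y) volume := by
  rw [rollnikIntegral_eq_lintegral_prod hV] at hfin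
  exact ae_integrable_smul_of_kernel (K := fun x y => ‖x - y‖ ^ (2 * α - 2 * (d : ℝ)))
    hα.const_pos.le (measurable_riesz_kernel _)
    hα.ae_lintegral_riesz_kernel hV hfin

theorem memLp_rieszPotential : MemLp (rieszPotential (α - (d : ℝ) / 2) V) 2 volume := by
  rw [rollnikIntegral_eq_lintegral_prod hV] at hfin
  exact (memLp_integral_smul_of_kernel (K := fun x y => ‖x - y‖ ^ (2 * α - 2 * (d : ℝ)))
    hα.const_pos.le (measurable_riesz_kernel _)
    hα.ae_lintegral_riesz_kernel hV hfin).const_smul (rieszGamma d (α - (d : ℝ) / 2))⁻¹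

theorem rollnikSignedIntegral_eq :
    rollnikSignedIntegral α V = ((rieszGamma d (2 * α - (d : ℝ)) *
      (eLpNorm (rieszPotential (α - (d : ℝ) / 2) V) 2 volume).toReal ^ 2 : ℝ) : 𝕜) := by
  have hfin' := hfin
  rw [rollnikIntegral_eq_lintegral_prod hV] at hfin'
  have h := integral_sq_norm_integral_smul_eq (K := fun x y => ‖x - y‖ ^ (2 * α - 2 * (d : ℝ)))
    hα.const_pos.le (measurable_riesz_kernel _)
    (fun _ _ => by positivity) hα.ae_lintegral_riesz_kernel hV hfin'
    (Filter.Eventually.of_forall fun p => by positivity)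
  rw [← rollnikSignedIntegral_eq_integral_prod hV hfin] at h
  have h1 := hα.rieszGamma_order_pos
  have h2 := hα.rieszGamma_two_mul_order_pos
  rw [(hα.memLp_rieszPotential hV hfin).toReal_eLpNorm_two_sq]
  have e : ∀ x, ‖rieszPotential (α - (d : ℝ) / 2) V x‖ ^ 2 =
      (rieszGamma d (α - (d : ℝ) / 2) ^ 2)⁻¹ *
        ‖∫ y, (‖x - y‖ ^ ((d : ℝ) - (α - (d : ℝ) / 2)))⁻¹ • V y‖ ^ 2 := fun x => by
    rw [rieszPotential, norm_smul, mul_pow, Real.norm_of_nonneg (by positivity), inv_pow]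
  simp_rw [e]
  rw [integral_const_mul, RCLike.ofReal_mul, RCLike.ofReal_mul, h, RCLike.real_smul_eq_coe_mul,
    ← mul_assoc, ← mul_assoc, ← RCLike.ofReal_mul, ← RCLike.ofReal_mul]
  have e1 : ∀ {a b : ℝ}, 0 < a → 0 < b → b * (a ^ 2)⁻¹ * (a ^ 2 / b) = 1 := fun ha hb => by
    field_simp
  rw [e1 h1 h2, RCLike.ofReal_one, one_mul]

/-- On a ball of radius `1 / 2` the kernel is at least `1`, so the square of the integral of `|V|` over
it is at most the Rollnik integral. -/
theorem locallyIntegrable : LocallyIntegrable V := by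
  intro x
  refine ⟨Metric.closedBall x (1 / 2), Metric.closedBall_mem_nhds x (by norm_num),
    hV.aestronglyMeasurable, ?_⟩
  have h1 : (∫⁻ y in Metric.closedBall x (1 / 2), ‖V y‖ₑ) ^ 2 ≤ rollnikIntegral α V := by
    rw [rollnikIntegral_eq_lintegral_prod hV, sq,
      ← lintegral_prod_mul hV.enorm.aemeasurable hV.enorm.aemeasurable, Measure.prod_restrict]
    refine le_trans ?_ (setLIntegral_le_lintegral
      (Metric.closedBall x (1 / 2) ×ˢ Metric.closedBall x (1 / 2)) _)
    apply lintegral_mono_ae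
    filter_upwards [ae_restrict_of_ae (ae_prod_ne hα.dim_pos), ae_restrict_mem
      (Metric.isClosed_closedBall.measurableSet.prod Metric.isClosed_closedBall.measurableSet)]
      with p hp hp'
    have h2 : 0 < ‖p.1 - p.2‖ := norm_pos_iff.2 (sub_ne_zero.2 hp)
    have h3 : ‖p.1 - p.2‖ ≤ 1 := by
      have := dist_triangle_right p.1 p.2 x
      have h4 := Metric.mem_closedBall.1 hp'.1
      have h5 := Metric.mem_closedBall.1 hp'.2
      rw [← dist_eq_norm]
      linarith
    have h4 := Real.one_le_rpow_of_pos_of_le_one_of_nonpos h2 h3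
      (show 2 * α - 2 * (d : ℝ) ≤ 0 by linarith [hα.lt])
    exact le_mul_of_one_le_left' (ENNReal.one_le_ofReal.2 h4)
  exact (ENNReal.pow_lt_top_iff.1 (h1.trans_lt hfin)).resolve_right (by norm_num)

/-- Definiteness of the signed form, from its representation as an integral of squares of integrals
over balls. -/
theorem ae_eq_zero_of_rollnikSignedIntegral_eq_zero (h : rollnikSignedIntegral α V = 0) :
    V =ᵐ[volume] 0 := by
  obtain ⟨C, hC, hK⟩ := exists_lintegral_ballKernel_mul_ballKernel hα.dim_pos
    (show 0 < -(2 * α - 2 * (d : ℝ)) by linarith [hα.lt])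
  simp only [neg_neg] at hK
  have hK' := (ae_prod_ne hα.dim_pos).mono fun p hp => hK p.1 p.2 hp
  have hfin' := hfin
  rw [rollnikIntegral_eq_lintegral_prod hV] at hfin'
  have hid := integral_sq_norm_integral_smul_eq (K := fun x y => ‖x - y‖ ^ (2 * α - 2 * (d : ℝ)))
    hC (measurable_ballKernel _)
    (fun _ _ => ballKernel_nonneg _ _ _) hK' hV hfin'
    (Filter.Eventually.of_forall fun p => by positivity)
  rw [← rollnikSignedIntegral_eq_integral_prod hV hfin, h, smul_zero, RCLike.ofReal_eq_zero] at hid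
  have hmem := memLp_integral_smul_of_kernel (K := fun x y => ‖x - y‖ ^ (2 * α - 2 * (d : ℝ)))
    hC (measurable_ballKernel _) hK' hV hfin'
  rw [integral_eq_zero_iff_of_nonneg (fun _ => by positivity)
    ((memLp_two_iff_integrable_sq_norm hmem.1).1 hmem)] at hid
  refine ae_eq_zero_of_integral_ballKernel_smul_eq_zero
    (s := (-(2 * α - 2 * (d : ℝ)) + d + 1) / 2) (hα.locallyIntegrable hV hfin) ?_
  filter_upwards [hid] with ω hω
  simpa using hω

end RollnikExponent

end Rollnik

/-! ### The two norms -/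

namespace RollnikExponent

variable {𝕜 : Type*} [RCLike 𝕜] {d : ℕ} {α : ℝ} (hα : RollnikExponent d α)
  {V W : EuclideanSpace ℝ (Fin d) →ₘ[volume] 𝕜}
include hα

theorem rollnikSignedNorm_eq (hV : V ∈ rollnikClass 𝕜 d α) :
    rollnikSignedNorm α V = Real.sqrt (rieszGamma d (2 * α - (d : ℝ))) *
      (eLpNorm (rieszPotential (α - (d : ℝ) / 2) V) 2 volume).toReal := by
  have h := hα.rieszGamma_two_mul_order_pos
  rw [rollnikSignedNorm, hα.rollnikSignedIntegral_eq V.measurable hV, RCLike.ofReal_re,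
    Real.sqrt_mul h.le, Real.sqrt_sq ENNReal.toReal_nonneg]

theorem rollnikNorm_eq (hV : V ∈ rollnikClass 𝕜 d α) :
    rollnikNorm α V = Real.sqrt (rieszGamma d (2 * α - (d : ℝ))) *
      (eLpNorm (rieszPotential (α - (d : ℝ) / 2) fun x => ‖V x‖) 2 volume).toReal := by
  have h := hα.rieszGamma_two_mul_order_pos
  have hV' : rollnikIntegral α (fun x => ‖V x‖) < ∞ := by rwa [rollnikIntegral_norm]
  have e := hα.rollnikSignedIntegral_eq V.measurable.norm hV'
  rw [rollnikSignedIntegral_norm V.measurable hV, RCLike.ofReal_real_eq_id, id] at e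
  rw [rollnikNorm, e, Real.sqrt_mul h.le, Real.sqrt_sq ENNReal.toReal_nonneg]

theorem add_mem (hV : V ∈ rollnikClass 𝕜 d α) (hW : W ∈ rollnikClass 𝕜 d α) :
    V + W ∈ rollnikClass 𝕜 d α := by
  have := hα.rollnikIntegral_add_lt_top V.measurable W.measurable hV hW
  rwa [← rollnikIntegral_congr (AEEqFun.coeFn_add V W)] at this

theorem smul_mem (c : 𝕜) (hV : V ∈ rollnikClass 𝕜 d α) : c • V ∈ rollnikClass 𝕜 d α := by
  have := hα.rollnikIntegral_const_smul_lt_top c V.measurable hV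
  rwa [← rollnikIntegral_congr (AEEqFun.coeFn_smul c V)] at this

theorem rollnikSignedNorm_smul (c : 𝕜) (hV : V ∈ rollnikClass 𝕜 d α) :
    rollnikSignedNorm α (c • V) = ‖c‖ * rollnikSignedNorm α V := by
  rw [hα.rollnikSignedNorm_eq hV, hα.rollnikSignedNorm_eq (hα.smul_mem c hV),
    rieszPotential_congr (AEEqFun.coeFn_smul c V), rieszPotential_const_smul, eLpNorm_const_smul,
    ENNReal.toReal_mul, toReal_enorm]
  ring

theorem rollnikNorm_smul (c : 𝕜) (hV : V ∈ rollnikClass 𝕜 d α) :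
    rollnikNorm α (c • V) = ‖c‖ * rollnikNorm α V := by
  have h : (fun x => ‖(c • V) x‖) =ᵐ[volume] ‖c‖ • fun x => ‖V x‖ := by
    filter_upwards [AEEqFun.coeFn_smul c V] with x hx
    rw [hx, Pi.smul_apply, Pi.smul_apply, norm_smul, smul_eq_mul]
  rw [hα.rollnikNorm_eq hV, hα.rollnikNorm_eq (hα.smul_mem c hV),
    rieszPotential_congr h, rieszPotential_const_smul, eLpNorm_const_smul,
    ENNReal.toReal_mul, toReal_enorm, norm_norm]
  ring

theorem rollnikSignedNorm_add_le (hV : V ∈ rollnikClass 𝕜 d α) (hW : W ∈ rollnikClass 𝕜 d α) :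
    rollnikSignedNorm α (V + W) ≤ rollnikSignedNorm α V + rollnikSignedNorm α W := by
  rw [hα.rollnikSignedNorm_eq hV, hα.rollnikSignedNorm_eq hW,
    hα.rollnikSignedNorm_eq (hα.add_mem hV hW), ← mul_add,
    rieszPotential_congr (AEEqFun.coeFn_add V W)]
  refine mul_le_mul_of_nonneg_left (MemLp.toReal_eLpNorm_le_add
    (hα.memLp_rieszPotential V.measurable hV) (hα.memLp_rieszPotential W.measurable hW) ?_)
    (Real.sqrt_nonneg _)
  filter_upwards [hα.ae_integrable_riesz V.measurable hV,
    hα.ae_integrable_riesz W.measurable hW] with x hx hx'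
  simp only [rieszPotential, Pi.add_apply, smul_add]
  rw [integral_add hx hx', smul_add]

theorem rollnikNorm_add_le (hV : V ∈ rollnikClass 𝕜 d α) (hW : W ∈ rollnikClass 𝕜 d α) :
    rollnikNorm α (V + W) ≤ rollnikNorm α V + rollnikNorm α W := by
  have hV' : rollnikIntegral α (fun x => ‖V x‖) < ∞ := by rwa [rollnikIntegral_norm]
  have hW' : rollnikIntegral α (fun x => ‖W x‖) < ∞ := by rwa [rollnikIntegral_norm]
  have e : rieszPotential (α - (d : ℝ) / 2) (fun x => ‖(V + W) x‖) =
      rieszPotential (α - (d : ℝ) / 2) (fun x => ‖V x + W x‖) :=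
    rieszPotential_congr ((AEEqFun.coeFn_add V W).fun_comp norm)
  rw [hα.rollnikNorm_eq hV, hα.rollnikNorm_eq hW,
    hα.rollnikNorm_eq (hα.add_mem hV hW), ← mul_add, e]
  have key : ∀ᵐ x, ‖rieszPotential (α - (d : ℝ) / 2) (fun x => ‖V x + W x‖) x‖ ≤
      ‖rieszPotential (α - (d : ℝ) / 2) (fun x => ‖V x‖) x +
        rieszPotential (α - (d : ℝ) / 2) (fun x => ‖W x‖) x‖ := by
    filter_upwards [hα.ae_integrable_riesz V.measurable.norm hV',
      hα.ae_integrable_riesz W.measurable.norm hW'] with x hx hx'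
    exact norm_rieszPotential_norm_add_le hx hx'
  exact mul_le_mul_of_nonneg_left (MemLp.toReal_eLpNorm_le_add
    (hα.memLp_rieszPotential V.measurable.norm hV')
    (hα.memLp_rieszPotential W.measurable.norm hW') key) (Real.sqrt_nonneg _)

theorem rollnikSignedIntegral_eq_sq (hV : V ∈ rollnikClass 𝕜 d α) :
    rollnikSignedIntegral α V = ((rollnikSignedNorm α V ^ 2 : ℝ) : 𝕜) := by
  rw [hα.rollnikSignedNorm_eq hV, mul_pow, Real.sq_sqrt hα.rieszGamma_two_mul_order_pos.le]
  exact hα.rollnikSignedIntegral_eq V.measurable hV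

theorem eq_zero_of_rollnikSignedNorm_eq_zero (hV : V ∈ rollnikClass 𝕜 d α)
    (h : rollnikSignedNorm α V = 0) : V = 0 := by
  have h0 := hα.rollnikSignedIntegral_eq_sq hV
  rw [h, zero_pow two_ne_zero, RCLike.ofReal_zero] at h0
  exact AEEqFun.ext ((hα.ae_eq_zero_of_rollnikSignedIntegral_eq_zero V.measurable hV h0).trans
    AEEqFun.coeFn_zero.symm)

theorem isNormOn_rollnikSignedNorm :
    IsNormOn 𝕜 (rollnikClass 𝕜 d α) (rollnikSignedNorm α) where
  zero_mem := zero_mem_rollnikClass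
  add_mem _ hV _ hW := hα.add_mem hV hW
  smul_mem c _ hV := hα.smul_mem c hV
  nonneg _ _ := Real.sqrt_nonneg _
  eq_zero_iff V hV := by
    refine ⟨hα.eq_zero_of_rollnikSignedNorm_eq_zero hV, fun h => ?_⟩
    have := hα.rollnikSignedNorm_smul 0 hV
    rwa [zero_smul 𝕜 V, norm_zero, zero_mul, ← h] at this
  smul c _ hV := hα.rollnikSignedNorm_smul c hV
  add_le _ hV _ hW := hα.rollnikSignedNorm_add_le hV hW

theorem isNormOn_rollnikNorm : IsNormOn 𝕜 (rollnikClass 𝕜 d α) (rollnikNorm α) where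
  zero_mem := zero_mem_rollnikClass
  add_mem _ hV _ hW := hα.add_mem hV hW
  smul_mem c _ hV := hα.smul_mem c hV
  nonneg _ _ := Real.sqrt_nonneg _
  eq_zero_iff V hV := by
    refine ⟨fun h => hα.eq_zero_of_rollnikSignedNorm_eq_zero hV
      (le_antisymm (h ▸ rollnikSignedNorm_le_rollnikNorm hV) (Real.sqrt_nonneg _)), fun h => ?_⟩
    have := hα.rollnikNorm_smul 0 hV
    rwa [zero_smul 𝕜 V, norm_zero, zero_mul, ← h] at this
  smul c _ hV := hα.rollnikNorm_smul c hV
  add_le _ hV _ hW := hα.rollnikNorm_add_le hV hW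

end RollnikExponent

theorem theorem3p3 {𝕜 : Type*} [RCLike 𝕜] (d : ℕ) (α : ℝ)
    (hαd : α < (d : ℝ)) (hdα : (d : ℝ) < 2 * α) :
    IsNormOn 𝕜 (rollnikClass 𝕜 d α) (rollnikNorm α) ∧
    IsNormOn 𝕜 (rollnikClass 𝕜 d α) (rollnikSignedNorm α) ∧
    ∀ V ∈ rollnikClass 𝕜 d α,
      -- the signed double integral converges absolutely and is the (real) square of the norm
      (Integrable (fun p : EuclideanSpace ℝ (Fin d) × EuclideanSpace ℝ (Fin d) =>
          rollnikSignedIntegrand α V p.1 p.2) (volume.prod volume) ∧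
        rollnikSignedIntegral α V = ((rollnikSignedNorm α V ^ 2 : ℝ) : 𝕜)) ∧
      -- the Riesz potentials of `V` and `|V|` converge absolutely almost everywhere
      (∀ᵐ x : EuclideanSpace ℝ (Fin d), Integrable (fun y : EuclideanSpace ℝ (Fin d) =>
          (‖x - y‖ ^ ((d : ℝ) - (α - (d : ℝ) / 2)))⁻¹ • V y) volume) ∧
      -- they are square integrable, and the two identities hold
      MemLp (rieszPotential (α - (d : ℝ) / 2) V) 2 volume ∧
      MemLp (rieszPotential (α - (d : ℝ) / 2) (fun x => ‖V x‖)) 2 volume ∧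
      rollnikSignedNorm α V ^ 2 = rieszGamma d (2 * α - (d : ℝ)) *
        (eLpNorm (rieszPotential (α - (d : ℝ) / 2) V) 2 volume).toReal ^ 2 ∧
      rollnikNorm α V ^ 2 = rieszGamma d (2 * α - (d : ℝ)) *
        (eLpNorm (rieszPotential (α - (d : ℝ) / 2) (fun x => ‖V x‖)) 2 volume).toReal ^ 2 := by
  have hα : RollnikExponent d α := ⟨hαd, hdα⟩
  refine ⟨hα.isNormOn_rollnikNorm, hα.isNormOn_rollnikSignedNorm, fun V hV => ⟨⟨?_, ?_⟩,
    ?_, ?_, ?_, ?_, ?_⟩⟩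
  · exact integrable_rollnikSignedIntegrand V.measurable hV
  · exact hα.rollnikSignedIntegral_eq_sq hV
  · exact hα.ae_integrable_riesz V.measurable hV
  · exact hα.memLp_rieszPotential V.measurable hV
  · exact hα.memLp_rieszPotential V.measurable.norm (by rwa [rollnikIntegral_norm])
  · rw [hα.rollnikSignedNorm_eq hV, mul_pow, Real.sq_sqrt hα.rieszGamma_two_mul_order_pos.le]
  · rw [hα.rollnikNorm_eq hV, mul_pow, Real.sq_sqrt hα.rieszGamma_two_mul_order_pos.le]
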